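/- Let $k$ be a field, $S=k[x_1,\dots,x_n]$ with the standard grading, $I\subseteq S$ a graded ideal, and $\delta\ge 0$ an integer. For integers $s\ge 0$ and $p\ge 1$, the $p$-th Macaulay representation of $s$ is the expression $s=\sum_{i=1}^{p}\binom{s_i}{i}$ with integers $0\le s_1<s_2<\cdots<s_p$, where $\binom{a}{b}=0$ if $a<b$; the $s_i$ are the $p$-th Macaulay coefficients of $s$. (1) Let $\delta\ge 1$. Then $\dim_k(S/I)_\delta$ has a unique $\delta$-th Macaulay representation $\dim_k(S/I)_\delta=\sum_{i=1}^{\delta}\binom{t_i}{i}$, and $$\dim_k(S/I)_{\delta+1}\le\sum_{i=1}^{\delta}\binom{t_i+1}{i+1}.$$ (2) Let $n\ge 2$. Then $\dim_k I_\delta$ has a unique $(n-1)$-th Macaulay representation $\dim_k I_\delta=\sum_{i=1}^{n-1}\binom{s_i}{i}$, and $$\dim_k I_{\delta+1}\ge\sum_{\substack{1\le i\le n-1\\ s_i\ge i}}\binom{s_i+1}{i},$$ where the sum runs over the nonvanishing terms of the representation. In particular, if $s_i\ge i$ for all $i$, then $\dim_k I_{\delta+1}\ge\sum_{i=1}^{n-1}\binom{s_i+1}{i}$.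 -/

import Mathlib

attribute [local instance] MvPolynomial.gradedAlgebra

/-- `t` lists the `p`-th Macaulay coefficients of `s`, in increasing order (the
usual index `i = 1, …, p` is `j + 1` for `j : Fin p`): nonnegative integers
`t₁ < ⋯ < t_p` with `s = ∑ᵢ (tᵢ choose i)`, where `(a choose b) = 0` for `a < b`. -/
def IsMacaulayRep (p s : ℕ) (t : Fin p → ℕ) : Prop :=
  StrictMono t ∧ s = ∑ j : Fin p, (t j).choose (j + 1)

noncomputable section

/-- The degree-`d` component `I_d = I ∩ S_d` of an ideal `I` of `S = k[x₁, …, xₙ]`. -/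
def idealComponent {k : Type*} [Field k] {n : ℕ} (I : Ideal (MvPolynomial (Fin n) k)) (d : ℕ) :
    Submodule k (MvPolynomial (Fin n) k) :=
  I.restrictScalars k ⊓ MvPolynomial.homogeneousSubmodule (Fin n) k d

/-- The degree-`d` component `(S/I)_d` of `S/I`: the image of `S_d` under `S → S/I`. -/
def quotientComponent {k : Type*} [Field k] {n : ℕ} (I : Ideal (MvPolynomial (Fin n) k)) (d : ℕ) :
    Submodule k (MvPolynomial (Fin n) k ⧸ I) :=
  (MvPolynomial.homogeneousSubmodule (Fin n) k d).map (Ideal.Quotient.mkₐ k I).toLinearMap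

end

/-! Lexicographic leading monomials reduce both bounds to counting. A space of forms of one degree
has as many leading monomials as its dimension, and the leading monomials of `I_(d+1)` contain all
variable multiples of those of `I_d`. It remains to bound below the number of multiples of `s`
monomials of degree `d` by that of the lexicographic segment of size `s`
(`lexGrowth_card_le_card_upperShadow`), and to read the latter off Macaulay coefficients.

For the first task, compressions make the set `A` closed under replacing a factor `x₀` by any other
variable, without increasing the number of multiples. Let `A` have `a` members free of `x₀` and `b`
divisible by it. The multiples of `A` include `x₀ · A` and the multiples of the `x₀`-free part in
the other variables, so induction gives at least `a + b + lexGrowth n (d + 1) a` of them. Closure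
puts all multiples of the `b` quotients by `x₀` inside `A`, so induction on the degree bounds the
growth of `b` by `a + b`. That these two facts suffice is the numerical inequality
`lexGrowth_add_le`.

For the second task, a segment either lies in the multiples of the largest variable `x`, or contains
them all and continues in one variable fewer. Removing the top binomial coefficient follows this
recursion. For `I_δ` that coefficient counts the multiples of `x` (`IsMacaulayRep.le_lexGrowth`);
for the complement, of size `dim (S/I)_δ`, it counts the monomials free of `x`
(`IsMacaulayRep.monomialCount_le`). -/

/-! ### Growth of lexicographic segments -/

/-- The number of monomials of degree `e - 1` in `n` variables (none if `e = 0`). -/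
def monomialCount (n : ℕ) : ℕ → ℕ
  | 0 => 0
  | e + 1 => n.multichoose e

/-- The number of multiples, in the next degree, of the `s` lexicographically largest monomials of
degree `e - 1` in `n` variables. -/
def lexGrowth : ℕ → ℕ → ℕ → ℕ
  | 0, _, _ => 0
  | _ + 1, 0, _ => 0
  | n + 1, e + 1, s =>
    if s ≤ monomialCount (n + 1) e then lexGrowth (n + 1) e s
    else monomialCount (n + 1) (e + 1) + lexGrowth n (e + 1) (s - monomialCount (n + 1) e)

theorem monomialCount_succ_succ (n e : ℕ) :
    monomialCount (n + 1) (e + 1) = monomialCount (n + 1) e + monomialCount n (e + 1) := by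
  cases e with
  | zero => simp [monomialCount]
  | succ e => simp only [monomialCount, Nat.multichoose_succ_succ]; omega

theorem monomialCount_zero_right (n : ℕ) : monomialCount n 0 = 0 := rfl

theorem monomialCount_zero_succ_succ (e : ℕ) : monomialCount 0 (e + 1 + 1) = 0 := by
  simp [monomialCount]

theorem monomialCount_eq_choose (p e : ℕ) :
    monomialCount (p + 1 + 1) e = (p + e).choose (p + 1) := by
  cases e with
  | zero => simp [monomialCount]
  | succ e =>
    rw [monomialCount, Nat.multichoose_eq, show p + 1 + 1 + e - 1 = (p + 1) + e by omega,
      ← Nat.choose_symm_add]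
    congr 1
    omega

theorem monomialCount_eq_choose_degree (n q : ℕ) :
    monomialCount n (q + 1 + 1) = (n + q).choose (q + 1) := by
  rw [monomialCount, Nat.multichoose_eq]
  congr 1

theorem lexGrowth_zero_middle (n s : ℕ) : lexGrowth n 0 s = 0 := by
  cases n <;> simp [lexGrowth]

theorem lexGrowth_of_le {n e s : ℕ} (h : s ≤ monomialCount (n + 1) e) :
    lexGrowth (n + 1) (e + 1) s = lexGrowth (n + 1) e s := by
  rw [lexGrowth, if_pos h]

theorem lexGrowth_of_lt {n e s : ℕ} (h : monomialCount (n + 1) e < s) :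
    lexGrowth (n + 1) (e + 1) s =
      monomialCount (n + 1) (e + 1) + lexGrowth n (e + 1) (s - monomialCount (n + 1) e) := by
  rw [lexGrowth, if_neg (by omega)]

theorem lexGrowth_zero_right (n e : ℕ) : lexGrowth n e 0 = 0 := by
  induction e with
  | zero => exact lexGrowth_zero_middle n 0
  | succ e ih =>
    cases n with
    | zero => simp [lexGrowth]
    | succ n => rw [lexGrowth_of_le (Nat.zero_le _), ih]

theorem lexGrowth_full (n e : ℕ) (h : 1 ≤ e) :
    lexGrowth n e (monomialCount n e) = monomialCount n (e + 1) := by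
  induction n generalizing e with
  | zero =>
    obtain ⟨e, rfl⟩ : ∃ e', e = e' + 1 := ⟨e - 1, by omega⟩
    simp [lexGrowth, monomialCount]
  | succ n ihn =>
    induction e, h using Nat.le_induction with
    | base =>
      have := monomialCount_succ_succ n 1
      rw [lexGrowth_of_lt (by simp [monomialCount]), monomialCount_zero_right, this]
      simpa [monomialCount] using ihn 1 le_rfl
    | succ e he ihe =>
      have h1 := monomialCount_succ_succ n e
      have h2 := monomialCount_succ_succ n (e + 1)
      rcases Nat.eq_zero_or_pos (monomialCount n (e + 1)) with h0 | h0
      · rw [h0, add_zero] at h1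
        rw [lexGrowth_of_le h1.le, h1, ihe, h2]
        have := ihn (e + 1) (by omega)
        rw [h0, lexGrowth_zero_right] at this
        omega
      · rw [lexGrowth_of_lt (by omega), show monomialCount (n + 1) (e + 1) -
          monomialCount (n + 1) e = monomialCount n (e + 1) by omega, ihn _ (by omega), h2]

/-- At the threshold both branches of the definition agree, since a full degree grows to the full
next degree. This fails for `e = 0`, where the threshold is `0`. -/
theorem lexGrowth_of_ge {n e s : ℕ} (he : 1 ≤ e) (h : monomialCount (n + 1) e ≤ s) :
    lexGrowth (n + 1) (e + 1) s =
      monomialCount (n + 1) (e + 1) + lexGrowth n (e + 1) (s - monomialCount (n + 1) e) := by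
  rcases h.lt_or_eq with h | rfl
  · exact lexGrowth_of_lt h
  · rw [lexGrowth_of_le le_rfl, lexGrowth_full _ _ he, Nat.sub_self, lexGrowth_zero_right]
    rfl

theorem lexGrowth_mono (n e : ℕ) : Monotone (lexGrowth n e) := by
  induction n generalizing e with
  | zero => intro s t _; simp [lexGrowth]
  | succ n ihn =>
    induction e with
    | zero => intro s t _; simp [lexGrowth]
    | succ e ihe =>
      intro s t hst
      rcases le_or_gt t (monomialCount (n + 1) e) with ht | ht
      · rw [lexGrowth_of_le ht, lexGrowth_of_le (hst.trans ht)]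
        exact ihe hst
      · rw [lexGrowth_of_lt ht]
        rcases le_or_gt s (monomialCount (n + 1) e) with hs | hs
        · rw [lexGrowth_of_le hs]
          rcases Nat.eq_zero_or_pos e with rfl | he
          · simp [lexGrowth_zero_middle]
          · have := ihe hs
            rw [lexGrowth_full _ _ he] at this
            omega
        · rw [lexGrowth_of_lt hs]
          have := ihn (e + 1) (show s - monomialCount (n + 1) e ≤ t - monomialCount (n + 1) e by
            omega)
          omega

theorem le_lexGrowth (n e s : ℕ) (h : s ≤ monomialCount (n + 1) e) :
    s ≤ lexGrowth (n + 1) e s := by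
  induction n generalizing e s with
  | zero =>
    induction e with
    | zero => simp [monomialCount] at h; omega
    | succ e ihe =>
      rcases le_or_gt s (monomialCount 1 e) with hs | hs
      · rw [lexGrowth_of_le hs]; exact ihe hs
      · rw [lexGrowth_of_lt hs]; simp only [zero_add] at *; omega
  | succ n ihn =>
    induction e with
    | zero => simp [monomialCount] at h; omega
    | succ e ihe =>
      rcases le_or_gt s (monomialCount (n + 1 + 1) e) with hs | hs
      · rw [lexGrowth_of_le hs]; exact ihe hs
      · have h1 := monomialCount_succ_succ (n + 1) e
        have := ihn (e + 1) (s - monomialCount (n + 1 + 1) e) (by omega)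
        rw [lexGrowth_of_lt hs]
        omega

/-- Multiples of a lexicographic segment that involve the smallest variable are that variable times
the segment; the others are monomials in the remaining `n` variables. -/
theorem lexGrowth_le_add (n e s : ℕ) :
    lexGrowth (n + 1) e s ≤ s + monomialCount n (e + 1) := by
  induction n generalizing e s with
  | zero =>
    induction e with
    | zero => simp [lexGrowth]
    | succ e ihe =>
      rcases le_or_gt s (monomialCount 1 e) with hs | hs
      · rw [lexGrowth_of_le hs]
        rcases Nat.eq_zero_or_pos e with rfl | he
        · simp [lexGrowth]
        · obtain ⟨e, rfl⟩ : ∃ e', e = e' + 1 := ⟨e - 1, by omega⟩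
          simpa [monomialCount] using ihe
      · rw [lexGrowth_of_lt hs]
        simp [monomialCount, lexGrowth] at hs ⊢
        omega
  | succ n ihn =>
    induction e with
    | zero => simp [lexGrowth]
    | succ e ihe =>
      have h2 := monomialCount_succ_succ n (e + 1)
      rcases le_or_gt s (monomialCount (n + 1 + 1) e) with hs | hs
      · rw [lexGrowth_of_le hs]
        omega
      · have h1 := monomialCount_succ_succ (n + 1) e
        have := ihn (e + 1) (s - monomialCount (n + 1 + 1) e)
        rw [lexGrowth_of_lt hs]
        omega

theorem lexGrowth_add_le (n e a b : ℕ) (ha : a ≤ monomialCount n (e + 1))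
    (hb : b ≤ monomialCount (n + 1) e) (h : lexGrowth (n + 1) e b ≤ a + b) :
    lexGrowth (n + 1) (e + 1) (a + b) ≤ a + b + lexGrowth n (e + 1) a := by
  induction n generalizing e a b with
  | zero =>
    have := lexGrowth_le_add 0 (e + 1) (a + b)
    rw [monomialCount_zero_succ_succ] at this
    omega
  | succ n ihn =>
    induction e generalizing a b with
    | zero =>
      rw [monomialCount_zero_right] at hb
      obtain rfl : b = 0 := by omega
      rcases Nat.eq_zero_or_pos a with rfl | ha0
      · simp [lexGrowth_zero_right]
      · have : a = 1 := by simp [monomialCount] at ha; omega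
        subst this
        rw [lexGrowth_of_lt (by simp [monomialCount])]
        simp [monomialCount]
    | succ e ihe =>
      have N1 := monomialCount_succ_succ (n + 1) e
      have N2 := monomialCount_succ_succ (n + 1) (e + 1)
      have N3 := monomialCount_succ_succ n (e + 1)
      rcases le_or_gt (a + b) (monomialCount (n + 1 + 1) (e + 1)) with hs | hs
      -- Otherwise the growth of `b` would contain all multiples of the largest variable and exceed
      -- `a + b`.
      · have hb' : b ≤ monomialCount (n + 1 + 1) e := by
          by_contra! hlt
          rw [lexGrowth_of_lt hlt] at h
          have := le_lexGrowth n (e + 1) (b - monomialCount (n + 1 + 1) e) (by omega)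
          omega
        rw [lexGrowth_of_le hs]
        rcases le_or_gt a (monomialCount (n + 1) (e + 1)) with ha' | ha'
        · rw [lexGrowth_of_le ha']
          rw [lexGrowth_of_le hb'] at h
          exact ihe a b ha' hb' h
        · have := lexGrowth_le_add (n + 1) (e + 1) (a + b)
          rw [lexGrowth_of_lt ha']
          omega
      · rw [lexGrowth_of_lt hs]
        rcases lt_or_ge a (monomialCount (n + 1) (e + 1)) with ha' | ha'
        · exfalso
          have hlt : monomialCount (n + 1 + 1) e < b := by omega
          rw [lexGrowth_of_lt hlt] at h
          have := le_lexGrowth n (e + 1) (b - monomialCount (n + 1 + 1) e) (by omega)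
          omega
        · rw [lexGrowth_of_ge (by omega) ha']
          -- Compare what remains of `a + b` and of `a` after the multiples of the largest variable
          -- are removed. If the former is not larger, monotonicity suffices; if it is, `b` also
          -- exceeds its threshold and induction applies to the remainders.
          rcases le_or_gt (a + b - monomialCount (n + 1 + 1) (e + 1))
            (a - monomialCount (n + 1) (e + 1)) with h1 | h1
          · have k1 := ihn (e + 1) (a + b - monomialCount (n + 1 + 1) (e + 1)) 0 (by omega)
              (Nat.zero_le _) (by rw [lexGrowth_zero_right]; omega)
            have k2 := lexGrowth_mono n (e + 1 + 1) h1
            simp only [add_zero] at k1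
            omega
          · have hlt : monomialCount (n + 1 + 1) e < b := by omega
            rw [lexGrowth_of_lt hlt] at h
            have k := ihn (e + 1) (a - monomialCount (n + 1) (e + 1))
              (b - monomialCount (n + 1 + 1) e) (by omega) (by omega) (by omega)
            rw [show a - monomialCount (n + 1) (e + 1) + (b - monomialCount (n + 1 + 1) e) =
              a + b - monomialCount (n + 1 + 1) (e + 1) by omega] at k
            omega

/-! ### Macaulay representations -/

/-- Pascal's rule, applied from the top term. It forces the top coefficient to be the greedy choice,
whence uniqueness. -/
theorem sum_choose_lt_choose {p : ℕ} (t : Fin p → ℕ) (ht : StrictMono t) (m : ℕ)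
    (hm : ∀ j, t j < m) : ∑ j : Fin p, (t j).choose (j + 1) < m.choose p := by
  induction p generalizing m with
  | zero => simp
  | succ p ih =>
    rw [Fin.sum_univ_castSucc]
    have h1 := ih (fun j => t j.castSucc) (ht.comp Fin.strictMono_castSucc) (t (Fin.last p))
      (fun j => ht (Fin.castSucc_lt_last j))
    have h2 : (t (Fin.last p) + 1).choose (p + 1) ≤ m.choose (p + 1) :=
      Nat.choose_le_choose _ (hm _)
    rw [Nat.choose_succ_succ'] at h2
    simp only [Fin.val_castSucc, Fin.val_last] at *
    omega

theorem le_last_of_choose_le_sum {p : ℕ} {t : Fin (p + 1) → ℕ} (ht : StrictMono t) {m : ℕ}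
    (h : m.choose (p + 1) ≤ ∑ j : Fin (p + 1), (t j).choose (j + 1)) : m ≤ t (Fin.last p) := by
  by_contra! hlt
  exact (sum_choose_lt_choose t ht m fun j =>
    (ht.monotone (Fin.le_last j)).trans_lt hlt).not_ge h

theorem last_le_of_sum_lt_choose {p : ℕ} {t : Fin (p + 1) → ℕ} {m : ℕ}
    (h : ∑ j : Fin (p + 1), (t j).choose (j + 1) < (m + 1).choose (p + 1)) :
    t (Fin.last p) ≤ m := by
  by_contra! hlt
  rw [Fin.sum_univ_castSucc, Fin.val_last] at h
  have := Nat.choose_le_choose (p + 1) (show m + 1 ≤ t (Fin.last p) from hlt)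
  omega

theorem IsMacaulayRep.dropLast {p s : ℕ} {t : Fin (p + 1) → ℕ} (h : IsMacaulayRep (p + 1) s t) :
    IsMacaulayRep p (s - (t (Fin.last p)).choose (p + 1)) (fun j => t j.castSucc) := by
  refine ⟨h.1.comp Fin.strictMono_castSucc, ?_⟩
  rw [h.2, Fin.sum_univ_castSucc]
  simp

theorem IsMacaulayRep.unique {p s : ℕ} {t u : Fin p → ℕ} (ht : IsMacaulayRep p s t)
    (hu : IsMacaulayRep p s u) : t = u := by
  induction p generalizing s with
  | zero => exact Subsingleton.elim _ _
  | succ p ih =>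
    have key : ∀ {t u : Fin (p + 1) → ℕ}, IsMacaulayRep (p + 1) s t → IsMacaulayRep (p + 1) s u →
        t (Fin.last p) ≤ u (Fin.last p) := by
      intro t u ht hu
      apply le_last_of_choose_le_sum hu.1
      rw [← hu.2, ht.2, Fin.sum_univ_castSucc, Fin.val_last]
      omega
    have hl := le_antisymm (key ht hu) (key hu ht)
    have hi := ht.dropLast
    rw [hl] at hi
    have := ih hi hu.dropLast
    funext j
    refine Fin.lastCases hl (fun j => congrFun this j) j

/-- Greedy construction; the bound by `m` is carried along so that appending `m` keeps the sequence
strictly increasing. -/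
theorem exists_macaulayRep_lt (p m s : ℕ) (h : s < m.choose p) :
    ∃ t : Fin p → ℕ, IsMacaulayRep p s t ∧ ∀ j, t j < m := by
  induction m generalizing p s with
  | zero =>
    cases p with
    | zero => exact ⟨Fin.elim0, ⟨fun i => i.elim0, by simpa using h⟩, fun i => i.elim0⟩
    | succ p => simp at h
  | succ m ih =>
    cases p with
    | zero => exact ⟨Fin.elim0, ⟨fun i => i.elim0, by simpa using h⟩, fun i => i.elim0⟩
    | succ p =>
      rcases lt_or_ge s (m.choose (p + 1)) with hs | hs
      · obtain ⟨t, ht, hm⟩ := ih _ _ hs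
        exact ⟨t, ht, fun j => (hm j).trans (Nat.lt_succ_self m)⟩
      · rw [Nat.choose_succ_succ'] at h
        obtain ⟨t, ht, hm⟩ := ih p (s - m.choose (p + 1)) (by omega)
        refine ⟨Fin.snoc (α := fun _ => ℕ) t m, ⟨?_, ?_⟩, ?_⟩
        · intro i j hij
          induction j using Fin.lastCases with
          | last =>
            induction i using Fin.lastCases with
            | last => exact absurd hij (lt_irrefl _)
            | cast i => simpa using hm i
          | cast j =>
            induction i using Fin.lastCases with
            | last => exact absurd hij (Fin.le_last _).not_gt
            | cast i => simpa using ht.1 (Fin.castSucc_lt_castSucc_iff.1 hij)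
        · have := ht.2
          rw [Fin.sum_univ_castSucc]
          simp
          omega
        · intro j
          induction j using Fin.lastCases with
          | last => simp
          | cast j => simpa using (hm j).trans (Nat.lt_succ_self m)

theorem lt_choose_add (p s : ℕ) : s < (s + p + 1).choose (p + 1) := by
  induction p with
  | zero => simp
  | succ p ih =>
    rw [Nat.choose_succ_succ']
    have : s + (p + 1) = s + p + 1 := by omega
    rw [this]
    omega

theorem existsUnique_macaulayRep (p s : ℕ) (hp : 1 ≤ p) :
    ∃! t : Fin p → ℕ, IsMacaulayRep p s t := by
  obtain ⟨p, rfl⟩ : ∃ q, p = q + 1 := ⟨p - 1, by omega⟩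
  obtain ⟨t, ht, -⟩ := exists_macaulayRep_lt (p + 1) _ s (lt_choose_add p s)
  exact ⟨t, ht, fun u hu => hu.unique ht⟩

/-! ### Lexicographic growth in Macaulay coefficients -/

theorem IsMacaulayRep.le_lexGrowth {p s : ℕ} {t : Fin p → ℕ} (h : IsMacaulayRep p s t) (e : ℕ)
    (hs : s ≤ monomialCount (p + 1) e) :
    ∑ j : Fin p, (if (j : ℕ) + 1 ≤ t j then (t j + 1).choose (j + 1) else 0) ≤
      lexGrowth (p + 1) e s := by
  induction p generalizing s e with
  | zero => simp
  | succ p ihp =>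
    induction e with
    | zero =>
      rw [monomialCount_zero_right, Nat.le_zero] at hs
      refine (Finset.sum_eq_zero fun j _ => ?_).le.trans (Nat.zero_le _)
      have h0 := h.2
      rw [hs, eq_comm, Finset.sum_eq_zero_iff] at h0
      have := h0 j (Finset.mem_univ j)
      rw [Nat.choose_eq_zero_iff] at this
      rw [if_neg (by omega)]
    | succ e ihe =>
      rcases le_or_gt s (monomialCount (p + 1 + 1) e) with hs' | hs'
      · rw [lexGrowth_of_le hs']
        exact ihe hs'
      have e1 := monomialCount_eq_choose p e
      have e2 := monomialCount_eq_choose p (e + 1)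
      have e3 := monomialCount_eq_choose p (e + 1 + 1)
      have hdrop := h.dropLast
      rw [Fin.sum_univ_castSucc]
      simp only [Fin.val_castSucc, Fin.val_last]
      rcases hs.lt_or_eq with hlt | heq
      -- The top binomial coefficient counts the multiples of the largest variable.
      · have hl : t (Fin.last p) = p + e := by
          apply le_antisymm
          · apply last_le_of_sum_lt_choose
            rw [← h.2, add_assoc, ← e2]
            exact hlt
          · apply le_last_of_choose_le_sum h.1
            rw [← h.2, ← e1]
            exact hs'.le
        rw [hl, ← e1] at hdrop
        have N := monomialCount_succ_succ (p + 1) e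
        have := ihp hdrop (e + 1) (by omega)
        rw [lexGrowth_of_lt hs', hl, e2]
        split_ifs
        · rw [add_assoc p e 1]
          omega
        · omega
      -- A full degree is a single binomial coefficient, so the lower terms vanish.
      · have hl : t (Fin.last p) = p + e + 1 := by
          apply le_antisymm
          · apply last_le_of_sum_lt_choose
            rw [← h.2, heq, e2, Nat.choose_succ_succ' (p + e + 1) p]
            have : 0 < (p + e + 1).choose p := Nat.choose_pos (by omega)
            rw [← add_assoc p e 1]
            omega
          · apply le_last_of_choose_le_sum h.1
            rw [← h.2, heq, e2, add_assoc]
        have hz : s - (p + e + 1).choose (p + 1) = 0 := by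
          rw [heq, e2, add_assoc, Nat.sub_self]
        rw [hl, hz] at hdrop
        have := ihp hdrop 0 (Nat.zero_le _)
        rw [lexGrowth_zero_right] at this
        rw [heq, lexGrowth_full _ _ (by omega), e3, hl, if_pos (by omega),
          show p + e + 1 + 1 = p + (e + 1 + 1) by omega]
        omega

theorem IsMacaulayRep.monomialCount_le {q s : ℕ} {t : Fin q → ℕ} (h : IsMacaulayRep q s t) (n : ℕ)
    (hs : s ≤ monomialCount n (q + 1)) :
    monomialCount n (q + 1 + 1) ≤ lexGrowth n (q + 1) (monomialCount n (q + 1) - s) +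
      ∑ j : Fin q, (t j + 1).choose ((j + 1) + 1) := by
  induction q generalizing s n with
  | zero =>
    have : s = 0 := by simpa using h.2
    subst this
    rw [Nat.sub_zero, lexGrowth_full _ _ le_rfl]
    simp
  | succ q ihq =>
    induction n with
    | zero => simp [monomialCount]
    | succ n ihn =>
      have N1 := monomialCount_succ_succ n (q + 1)
      have N2 := monomialCount_succ_succ n (q + 1 + 1)
      have e1 := monomialCount_eq_choose_degree n q
      have e2 := monomialCount_eq_choose_degree (n + 1) q
      have e3 := monomialCount_eq_choose_degree n (q + 1)
      have e4 := monomialCount_eq_choose_degree (n + 1) (q + 1)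
      rw [show n + 1 + q = n + q + 1 by omega] at e2
      rw [show n + 1 + (q + 1) = n + q + 1 + 1 by omega] at e4
      rw [← add_assoc n q 1] at e3
      rcases lt_or_ge s (monomialCount n (q + 1 + 1)) with hlt | hge
      -- The segment contains all multiples of the largest variable; its complement lives in `n`
      -- variables.
      · rw [lexGrowth_of_lt (by omega)]
        have := ihn hlt.le
        rw [show monomialCount (n + 1) (q + 1 + 1) - s - monomialCount (n + 1) (q + 1) =
          monomialCount n (q + 1 + 1) - s by omega]
        omega
      -- The complement contains every monomial free of the largest variable; what remains is
      -- divided by that variable.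
      · have hdrop := h.dropLast
        have hge' := hge
        rw [e1, h.2] at hge'
        have hl1 := le_last_of_choose_le_sum h.1 hge'
        rw [Fin.sum_univ_castSucc]
        simp only [Fin.val_castSucc, Fin.val_last]
        rcases hs.lt_or_eq with hlt | heq
        · have hl : t (Fin.last q) = n + q := by
            refine le_antisymm (last_le_of_sum_lt_choose ?_) hl1
            rw [← h.2, ← e2]
            exact hlt
          rw [hl, ← e1] at hdrop
          have := ihq hdrop (n + 1) (by omega)
          rw [lexGrowth_of_le (by omega), hl,
            show monomialCount (n + 1) (q + 1 + 1) - s = monomialCount (n + 1) (q + 1) -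
              (s - monomialCount n (q + 1 + 1)) by omega]
          omega
        · have hl : n + q + 1 ≤ t (Fin.last q) := by
            apply le_last_of_choose_le_sum h.1
            rw [← h.2, heq, e2]
          have := Nat.choose_le_choose (q + 1 + 1) (show n + q + 1 + 1 ≤ t (Fin.last q) + 1 by
            omega)
          omega

/-! ### Multiples of sets of monomials, and compression -/

/-- The monomials, as exponent vectors, which are a variable times a member of `A`. -/
def upperShadow {n : ℕ} (A : Finset (Fin n → ℕ)) : Finset (Fin n → ℕ) :=
  Finset.univ.biUnion fun i => A.image (· + Pi.single i 1)

theorem mem_upperShadow {n : ℕ} {A : Finset (Fin n → ℕ)} {u : Fin n → ℕ} :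
    u ∈ upperShadow A ↔ ∃ i, ∃ v ∈ A, v + Pi.single i 1 = u := by
  simp [upperShadow]

theorem add_single_mem_upperShadow {n : ℕ} {A : Finset (Fin n → ℕ)} {u : Fin n → ℕ} (hu : u ∈ A)
    (i : Fin n) : u + Pi.single i 1 ∈ upperShadow A :=
  mem_upperShadow.2 ⟨i, u, hu, rfl⟩

theorem upperShadow_subset_finAntidiagonal {n d : ℕ} {A : Finset (Fin n → ℕ)}
    (hA : A ⊆ Finset.finAntidiagonal n d) :
    upperShadow A ⊆ Finset.finAntidiagonal n (d + 1) := by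
  intro u hu
  obtain ⟨i, v, hv, rfl⟩ := mem_upperShadow.1 hu
  have := Finset.mem_finAntidiagonal.1 (hA hv)
  simp [Finset.sum_add_distrib, this]

/-- The exponent vector obtained by substituting the variable `i` for the variable `0`. -/
def mergeZero {n : ℕ} (i : Fin n) (u : Fin (n + 1) → ℕ) : Fin n → ℕ :=
  Fin.tail u + Pi.single i (u 0)

theorem mergeZero_add {n : ℕ} (i : Fin n) (u v : Fin (n + 1) → ℕ) :
    mergeZero i (u + v) = mergeZero i u + mergeZero i v := by
  funext j
  simp [mergeZero, Fin.tail, Pi.single_apply]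
  split_ifs <;> omega

theorem mergeZero_single_zero {n : ℕ} (i : Fin n) :
    mergeZero i (Pi.single 0 1) = Pi.single i 1 := by
  funext j
  simp [mergeZero, Fin.tail]

theorem mergeZero_single_succ {n : ℕ} (i j : Fin n) :
    mergeZero i (Pi.single j.succ 1) = Pi.single j 1 := by
  funext l
  simp [mergeZero, Fin.tail, Pi.single_apply, Fin.succ_inj, (Fin.succ_ne_zero j).symm]

theorem sum_mergeZero {n : ℕ} (i : Fin n) (u : Fin (n + 1) → ℕ) :
    ∑ j, mergeZero i u j = ∑ j, u j := by
  simp [mergeZero, Finset.sum_add_distrib, Fin.sum_univ_succ, Fin.tail, add_comm]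

theorem zero_le_mergeZero {n : ℕ} (i : Fin n) (u : Fin (n + 1) → ℕ) : u 0 ≤ mergeZero i u i := by
  simp [mergeZero]

theorem eq_of_mergeZero_eq {n : ℕ} {i : Fin n} {u v : Fin (n + 1) → ℕ}
    (h : mergeZero i u = mergeZero i v) (h0 : u 0 = v 0) : u = v := by
  funext j
  refine Fin.cases h0 (fun j => ?_) j
  have := congrFun h j
  simp only [mergeZero, h0, Pi.add_apply] at this
  exact Nat.add_right_cancel this

theorem mergeZero_cons {n : ℕ} (i : Fin n) (w : Fin n → ℕ) {a : ℕ} (ha : a ≤ w i) :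
    mergeZero i (Fin.cons a (w - Pi.single i a) : Fin (n + 1) → ℕ) = w := by
  funext j
  simp only [mergeZero, Fin.tail_cons, Fin.cons_zero, Pi.add_apply, Pi.sub_apply]
  rcases eq_or_ne j i with rfl | hj
  · simp [ha]
  · simp [hj]

/-- The members of `A` which become `w` when the variable `i` is substituted for `0`. -/
def mergeFiber {n : ℕ} (i : Fin n) (A : Finset (Fin (n + 1) → ℕ)) (w : Fin n → ℕ) :
    Finset (Fin (n + 1) → ℕ) :=
  A.filter fun v => mergeZero i v = w

theorem mem_mergeFiber {n : ℕ} {i : Fin n} {A : Finset (Fin (n + 1) → ℕ)} {w : Fin n → ℕ}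
    {u : Fin (n + 1) → ℕ} : u ∈ mergeFiber i A w ↔ u ∈ A ∧ mergeZero i u = w :=
  Finset.mem_filter

/-- The compression of `A`: every fiber of `mergeZero i` is replaced by the same number of
monomials with the lowest exponents of the variable `0`. -/
def compression {n : ℕ} (i : Fin n) (d : ℕ) (A : Finset (Fin (n + 1) → ℕ)) :
    Finset (Fin (n + 1) → ℕ) :=
  (Finset.finAntidiagonal (n + 1) d).filter fun u => u 0 < (mergeFiber i A (mergeZero i u)).card

theorem compression_subset {n : ℕ} (i : Fin n) (d : ℕ) (A : Finset (Fin (n + 1) → ℕ)) :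
    compression i d A ⊆ Finset.finAntidiagonal (n + 1) d :=
  Finset.filter_subset _ _

theorem mem_compression {n d : ℕ} {i : Fin n} {A : Finset (Fin (n + 1) → ℕ)}
    {u : Fin (n + 1) → ℕ} : u ∈ compression i d A ↔
      u ∈ Finset.finAntidiagonal (n + 1) d ∧ u 0 < (mergeFiber i A (mergeZero i u)).card :=
  Finset.mem_filter

theorem card_mergeFiber_le {n : ℕ} (i : Fin n) (A : Finset (Fin (n + 1) → ℕ)) (w : Fin n → ℕ) :
    (mergeFiber i A w).card ≤ w i + 1 := by
  rw [← Finset.card_range (w i + 1)]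
  refine Finset.card_le_card_of_injOn (fun u => u 0) (fun u hu => ?_) (fun u hu v hv h => ?_)
  · have := (mem_mergeFiber.1 hu).2
    have h0 := zero_le_mergeZero i u
    rw [this] at h0
    simpa using Nat.lt_succ_of_le h0
  · exact eq_of_mergeZero_eq ((mem_mergeFiber.1 hu).2.trans (mem_mergeFiber.1 hv).2.symm) h

theorem card_mergeFiber_compression {n d : ℕ} (i : Fin n) {A : Finset (Fin (n + 1) → ℕ)}
    (hA : A ⊆ Finset.finAntidiagonal (n + 1) d) (w : Fin n → ℕ) :
    (mergeFiber i (compression i d A) w).card = (mergeFiber i A w).card := by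
  rw [← Finset.card_range (mergeFiber i A w).card]
  refine Finset.card_bij (fun u _ => u 0) (fun u hu => ?_) (fun u hu v hv h => ?_) fun a ha => ?_
  · obtain ⟨h1, h2⟩ := mem_mergeFiber.1 hu
    have := (mem_compression.1 h1).2
    rw [h2] at this
    simpa using this
  · exact eq_of_mergeZero_eq ((mem_mergeFiber.1 hu).2.trans (mem_mergeFiber.1 hv).2.symm) h
  · rw [Finset.mem_range] at ha
    obtain ⟨v, hv⟩ := Finset.card_pos.1 (Nat.zero_lt_of_lt ha)
    obtain ⟨hvA, hvw⟩ := mem_mergeFiber.1 hv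
    have hle := card_mergeFiber_le i A w
    have hm := mergeZero_cons i w (show a ≤ w i by omega)
    refine ⟨Fin.cons a (w - Pi.single i a), mem_mergeFiber.2 ⟨mem_compression.2 ⟨?_, ?_⟩, hm⟩, rfl⟩
    · rw [Finset.mem_finAntidiagonal, ← sum_mergeZero i, hm, ← hvw, sum_mergeZero]
      exact Finset.mem_finAntidiagonal.1 (hA hvA)
    · rw [hm]
      simpa using ha

theorem map_mergeZero_compression {n d : ℕ} (i : Fin n) {A : Finset (Fin (n + 1) → ℕ)}
    (hA : A ⊆ Finset.finAntidiagonal (n + 1) d) :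
    (compression i d A).val.map (mergeZero i) = A.val.map (mergeZero i) := by
  ext w
  have := card_mergeFiber_compression i hA w
  simp only [mergeFiber, Finset.card_def, Finset.filter_val] at this
  simpa only [Multiset.count_map, eq_comm] using this

theorem sum_mergeZero_compression {n d : ℕ} (i : Fin n) {A : Finset (Fin (n + 1) → ℕ)}
    (hA : A ⊆ Finset.finAntidiagonal (n + 1) d) (f : (Fin n → ℕ) → ℕ) :
    ∑ u ∈ compression i d A, f (mergeZero i u) = ∑ u ∈ A, f (mergeZero i u) := by
  have := congrArg (fun s => (s.map f).sum) (map_mergeZero_compression i hA)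
  simp only [Multiset.map_map] at this
  exact this

theorem card_compression {n d : ℕ} (i : Fin n) {A : Finset (Fin (n + 1) → ℕ)}
    (hA : A ⊆ Finset.finAntidiagonal (n + 1) d) : (compression i d A).card = A.card := by
  simpa using sum_mergeZero_compression i hA fun _ => 1

theorem upperShadow_compression_subset {n d : ℕ} (i : Fin n) (A : Finset (Fin (n + 1) → ℕ)) :
    upperShadow (compression i d A) ⊆ compression i (d + 1) (upperShadow A) := by
  intro x hx
  have hx' := upperShadow_subset_finAntidiagonal (compression_subset i d A) hx
  obtain ⟨j, u, hu, rfl⟩ := mem_upperShadow.1 hx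
  refine mem_compression.2 ⟨hx', ?_⟩
  have hu0 := (mem_compression.1 hu).2
  have hinj : ∀ l : Fin (n + 1), Function.Injective fun v : Fin (n + 1) → ℕ => v + Pi.single l 1 :=
    fun l => add_left_injective _
  have hsub : ∀ l : Fin (n + 1), (mergeFiber i A (mergeZero i u)).image (· + Pi.single l 1) ⊆
      mergeFiber i (upperShadow A) (mergeZero i (u + Pi.single l 1)) := by
    intro l v hv
    obtain ⟨v, hv', rfl⟩ := Finset.mem_image.1 hv
    obtain ⟨hvA, hvu⟩ := mem_mergeFiber.1 hv'
    exact mem_mergeFiber.2 ⟨add_single_mem_upperShadow hvA l, by rw [mergeZero_add, mergeZero_add,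
      hvu]⟩
  induction j using Fin.cases with
  | succ j =>
    have := Finset.card_le_card (hsub j.succ)
    rw [Finset.card_image_of_injective _ (hinj _)] at this
    simpa using hu0.trans_le this
  | zero =>
    -- The target fiber must have one more element than the fiber of `u`. Multiplying by variable
    -- `i.succ` fills it injectively, and variable `0` times the member with largest exponent of `0`
    -- is new.
    obtain ⟨v, hv, hmax⟩ := Finset.exists_max_image _ (fun v : Fin (n + 1) → ℕ => v 0)
      (Finset.card_pos.1 (Nat.zero_lt_of_lt hu0))
    have hnot : v + Pi.single 0 1 ∉
        (mergeFiber i A (mergeZero i u)).image (· + Pi.single i.succ 1) := by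
      intro h
      obtain ⟨y, hy, hyv⟩ := Finset.mem_image.1 h
      have h1 := hmax y hy
      have h2 := congrFun hyv 0
      simp at h2
      omega
    have hi := hsub i.succ
    rw [mergeZero_add, mergeZero_single_succ, ← mergeZero_single_zero i, ← mergeZero_add] at hi
    have := Finset.card_le_card (Finset.insert_subset
      (hsub 0 (Finset.mem_image_of_mem _ hv)) hi)
    rw [Finset.card_insert_of_notMem hnot, Finset.card_image_of_injective _ (hinj _)] at this
    simp only [Pi.add_apply, Pi.single_eq_same]
    omega

theorem card_upperShadow_compression_le {n d : ℕ} (i : Fin n) {A : Finset (Fin (n + 1) → ℕ)}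
    (hA : A ⊆ Finset.finAntidiagonal (n + 1) d) :
    (upperShadow (compression i d A)).card ≤ (upperShadow A).card :=
  (Finset.card_le_card (upperShadow_compression_subset i A)).trans_eq
    (card_compression i (upperShadow_subset_finAntidiagonal hA))

/-- The fiber size `c` has the same total over both sets, while incoming members have exponent of
`0` below `c` and outgoing ones at least `c`. This makes repeated compression terminate. -/
theorem sum_compression_lt {n d : ℕ} (i : Fin n) {A : Finset (Fin (n + 1) → ℕ)}
    (hA : A ⊆ Finset.finAntidiagonal (n + 1) d) (hne : compression i d A ≠ A) :
    ∑ u ∈ compression i d A, u 0 < ∑ u ∈ A, u 0 := by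
  set c : (Fin n → ℕ) → ℕ := fun w => (mergeFiber i A w).card
  have hcard := card_compression i hA
  have hsum := sum_mergeZero_compression i hA c
  have hnonempty : (compression i d A \ A).Nonempty := by
    rw [Finset.nonempty_iff_ne_empty, Ne, Finset.sdiff_eq_empty_iff_subset]
    exact fun h => hne (Finset.eq_of_subset_of_card_le h hcard.ge)
  have h1 : ∑ u ∈ compression i d A \ A, u 0 < ∑ u ∈ compression i d A \ A, c (mergeZero i u) :=
    Finset.sum_lt_sum_of_nonempty hnonempty fun u hu =>
      (mem_compression.1 (Finset.mem_sdiff.1 hu).1).2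
  have h2 : ∑ u ∈ A \ compression i d A, c (mergeZero i u) ≤ ∑ u ∈ A \ compression i d A, u 0 := by
    refine Finset.sum_le_sum fun u hu => ?_
    obtain ⟨huA, hu⟩ := Finset.mem_sdiff.1 hu
    by_contra! hlt
    exact hu (mem_compression.2 ⟨hA huA, hlt⟩)
  have e1 := Finset.sum_inter_add_sum_sdiff (compression i d A) A fun u => u 0
  have e2 := Finset.sum_inter_add_sum_sdiff A (compression i d A) fun u => u 0
  have e3 := Finset.sum_inter_add_sum_sdiff (compression i d A) A fun u => c (mergeZero i u)
  have e4 := Finset.sum_inter_add_sum_sdiff A (compression i d A) fun u => c (mergeZero i u)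
  rw [Finset.inter_comm] at e2 e4
  omega

/-- `A` is closed under replacing a factor `0` by any other variable. -/
def IsZeroStable {n : ℕ} (A : Finset (Fin (n + 1) → ℕ)) : Prop :=
  ∀ u : Fin (n + 1) → ℕ, u + Pi.single 0 1 ∈ A → ∀ j, u + Pi.single j 1 ∈ A

theorem isZeroStable_of_compression_eq {n d : ℕ} {A : Finset (Fin (n + 1) → ℕ)}
    (hA : A ⊆ Finset.finAntidiagonal (n + 1) d) (h : ∀ i, compression i d A = A) :
    IsZeroStable A := by
  intro u hu j
  induction j using Fin.cases with
  | zero => exact hu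
  | succ i =>
    have hd := Finset.mem_finAntidiagonal.1 (hA hu)
    rw [← h i] at hu ⊢
    have h0 := (mem_compression.1 hu).2
    rw [mergeZero_add, mergeZero_single_zero] at h0
    refine mem_compression.2 ⟨?_, ?_⟩
    · simp only [Finset.mem_finAntidiagonal, Pi.add_apply, Finset.sum_add_distrib,
        Finset.sum_pi_single', Finset.mem_univ, if_true] at hd ⊢
      exact hd
    · rw [mergeZero_add, mergeZero_single_succ]
      refine lt_trans ?_ h0
      simp

theorem exists_isZeroStable {n d : ℕ} (A : Finset (Fin (n + 1) → ℕ))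
    (hA : A ⊆ Finset.finAntidiagonal (n + 1) d) :
    ∃ A' ⊆ Finset.finAntidiagonal (n + 1) d, A'.card = A.card ∧
      (upperShadow A').card ≤ (upperShadow A).card ∧ IsZeroStable A' := by
  induction hm : ∑ u ∈ A, u 0 using Nat.strong_induction_on generalizing A with
  | _ m ih =>
    by_cases h : ∀ i, compression i d A = A
    · exact ⟨A, hA, rfl, le_rfl, isZeroStable_of_compression_eq hA h⟩
    · push Not at h
      obtain ⟨i, hi⟩ := h
      obtain ⟨A', h1, h2, h3, h4⟩ := ih _ (hm ▸ sum_compression_lt i hA hi) (compression i d A)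
        (compression_subset i d A) rfl
      exact ⟨A', h1, h2.trans (card_compression i hA),
        h3.trans (card_upperShadow_compression_le i hA), h4⟩

/-! ### Splitting off one variable; minimality of lexicographic growth -/

/-- The members of `A` not involving the variable `0`, as monomials in the other variables. -/
def zeroFree {n : ℕ} (A : Finset (Fin (n + 1) → ℕ)) : Finset (Fin n → ℕ) :=
  (A.filter fun u => u 0 = 0).image Fin.tail

/-- The quotients by the variable `0` of the members of `A` divisible by it. -/
def zeroQuotient {n : ℕ} (A : Finset (Fin (n + 1) → ℕ)) : Finset (Fin (n + 1) → ℕ) :=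
  (A.filter fun u => u 0 ≠ 0).image (· - Pi.single 0 1)

theorem sub_single_zero_add {n : ℕ} {u : Fin (n + 1) → ℕ} (hu : u 0 ≠ 0) :
    u - Pi.single 0 1 + Pi.single 0 1 = u := by
  funext j
  refine Fin.cases ?_ (fun j => ?_) j
  · simp; omega
  · simp

theorem mem_zeroFree {n : ℕ} {A : Finset (Fin (n + 1) → ℕ)} {v : Fin n → ℕ} :
    v ∈ zeroFree A ↔ Fin.cons (α := fun _ => ℕ) 0 v ∈ A := by
  simp only [zeroFree, Finset.mem_image, Finset.mem_filter]
  constructor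
  · rintro ⟨u, ⟨hu, h0⟩, rfl⟩
    rwa [← h0, Fin.cons_self_tail]
  · exact fun h => ⟨_, ⟨h, rfl⟩, Fin.tail_cons _ _⟩

theorem mem_zeroQuotient {n : ℕ} {A : Finset (Fin (n + 1) → ℕ)} {u : Fin (n + 1) → ℕ} :
    u ∈ zeroQuotient A ↔ u + Pi.single 0 1 ∈ A := by
  simp only [zeroQuotient, Finset.mem_image, Finset.mem_filter]
  constructor
  · rintro ⟨u, ⟨hu, h0⟩, rfl⟩
    rwa [sub_single_zero_add h0]
  · exact fun h => ⟨_, ⟨h, by simp⟩, by simp⟩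

theorem card_eq_zeroFree_add_zeroQuotient {n : ℕ} (A : Finset (Fin (n + 1) → ℕ)) :
    A.card = (zeroFree A).card + (zeroQuotient A).card := by
  rw [zeroFree, zeroQuotient, Finset.card_image_of_injOn, Finset.card_image_of_injOn,
    Finset.card_filter_add_card_filter_not]
  · intro u hu v hv h
    rw [← sub_single_zero_add (Finset.mem_filter.1 hu).2,
      ← sub_single_zero_add (Finset.mem_filter.1 hv).2]
    exact congrArg (· + Pi.single 0 1) h
  · intro u hu v hv h
    rw [← Fin.cons_self_tail u, ← Fin.cons_self_tail v, (Finset.mem_filter.1 hu).2,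
      (Finset.mem_filter.1 hv).2, h]

theorem zeroFree_subset {n d : ℕ} {A : Finset (Fin (n + 1) → ℕ)}
    (hA : A ⊆ Finset.finAntidiagonal (n + 1) d) : zeroFree A ⊆ Finset.finAntidiagonal n d := by
  intro v hv
  simpa [Fin.sum_univ_succ] using Finset.mem_finAntidiagonal.1 (hA (mem_zeroFree.1 hv))

theorem zeroQuotient_subset {n d : ℕ} {A : Finset (Fin (n + 1) → ℕ)}
    (hA : A ⊆ Finset.finAntidiagonal (n + 1) (d + 1)) :
    zeroQuotient A ⊆ Finset.finAntidiagonal (n + 1) d := by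
  intro v hv
  simpa [Finset.sum_add_distrib] using Finset.mem_finAntidiagonal.1 (hA (mem_zeroQuotient.1 hv))

theorem zeroQuotient_eq_empty {n : ℕ} {A : Finset (Fin (n + 1) → ℕ)}
    (hA : A ⊆ Finset.finAntidiagonal (n + 1) 0) : zeroQuotient A = ∅ := by
  refine Finset.eq_empty_of_forall_notMem fun v hv => ?_
  simpa [Finset.sum_add_distrib] using Finset.mem_finAntidiagonal.1 (hA (mem_zeroQuotient.1 hv))

theorem card_finAntidiagonal (n d : ℕ) :
    (Finset.finAntidiagonal n d : Finset (Fin n → ℕ)).card = monomialCount n (d + 1) := by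
  induction n generalizing d with
  | zero =>
    cases d with
    | zero =>
      rw [show (Finset.finAntidiagonal 0 0 : Finset (Fin 0 → ℕ)) = {0} by
        ext u
        simp [Subsingleton.elim u 0]]
      simp [monomialCount]
    | succ d =>
      rw [show (Finset.finAntidiagonal 0 (d + 1) : Finset (Fin 0 → ℕ)) = ∅ by ext; simp]
      simp [monomialCount]
  | succ n ihn =>
    have hfree : ∀ d, zeroFree (Finset.finAntidiagonal (n + 1) d) =
        Finset.finAntidiagonal n d := by
      intro d
      ext v
      simp [mem_zeroFree, Fin.sum_univ_succ]
    induction d with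
    | zero =>
      rw [card_eq_zeroFree_add_zeroQuotient, hfree, zeroQuotient_eq_empty Finset.Subset.rfl, ihn]
      simp [monomialCount]
    | succ d ihd =>
      have : zeroQuotient (Finset.finAntidiagonal (n + 1) (d + 1)) =
          Finset.finAntidiagonal (n + 1) d := by
        ext v
        simp [mem_zeroQuotient, Finset.sum_add_distrib]
      rw [card_eq_zeroFree_add_zeroQuotient, hfree, this, ihn, ihd,
        monomialCount_succ_succ n (d + 1), add_comm]

theorem card_add_card_upperShadow_zeroFree_le {n : ℕ} (A : Finset (Fin (n + 1) → ℕ)) :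
    A.card + (upperShadow (zeroFree A)).card ≤ (upperShadow A).card := by
  rw [card_eq_zeroFree_add_zeroQuotient (upperShadow A), add_comm]
  refine Nat.add_le_add (Finset.card_le_card fun v hv => ?_) (Finset.card_le_card fun u hu => ?_)
  · obtain ⟨i, v, hvA, rfl⟩ := mem_upperShadow.1 hv
    rw [mem_zeroFree] at hvA ⊢
    refine mem_upperShadow.2 ⟨i.succ, _, hvA, ?_⟩
    funext j
    refine Fin.cases ?_ (fun j => ?_) j
    · simp
    · simp [Pi.single_apply, Fin.succ_inj]
  · exact mem_zeroQuotient.2 (add_single_mem_upperShadow hu 0)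

/-- Among the sets of `s` monomials of degree `d`, the lexicographic ones have the fewest multiples
in degree `d + 1`. -/
theorem lexGrowth_card_le_card_upperShadow {n d : ℕ} (A : Finset (Fin n → ℕ))
    (hA : A ⊆ Finset.finAntidiagonal n d) :
    lexGrowth n (d + 1) A.card ≤ (upperShadow A).card := by
  induction n generalizing d with
  | zero => simp [lexGrowth]
  | succ n ihn =>
    induction d generalizing A with
    | zero =>
      have h0 := ihn (zeroFree A) (zeroFree_subset hA)
      have hfree := Finset.card_le_card (zeroFree_subset hA)
      have hc := card_eq_zeroFree_add_zeroQuotient A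
      rw [zeroQuotient_eq_empty hA] at hc
      have hs := card_add_card_upperShadow_zeroFree_le A
      rw [card_finAntidiagonal] at hfree
      have := lexGrowth_add_le n 0 _ 0 hfree (Nat.zero_le _) (by simp [lexGrowth])
      simp only [Finset.card_empty, add_zero] at hc this
      rw [← hc] at this h0
      omega
    | succ d ihd =>
      obtain ⟨A', hA', hcard, hshadow, hstable⟩ := exists_isZeroStable A hA
      rw [← hcard]
      refine le_trans ?_ hshadow
      have h0 := ihn (zeroFree A') (zeroFree_subset hA')
      have h1 := ihd (zeroQuotient A') (zeroQuotient_subset hA')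
      -- Stability enters here, supplying the hypothesis of `lexGrowth_add_le`.
      have hsub : upperShadow (zeroQuotient A') ⊆ A' := by
        intro x hx
        obtain ⟨i, v, hv, rfl⟩ := mem_upperShadow.1 hx
        exact hstable v (mem_zeroQuotient.1 hv) i
      have hc := card_eq_zeroFree_add_zeroQuotient A'
      have hfree := Finset.card_le_card (zeroFree_subset hA')
      have hquot := Finset.card_le_card (zeroQuotient_subset hA')
      rw [card_finAntidiagonal] at hfree hquot
      have := lexGrowth_add_le n (d + 1) _ _ hfree hquot
        (hc ▸ h1.trans (Finset.card_le_card hsub))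
      rw [← hc] at this
      have := card_add_card_upperShadow_zeroFree_le A'
      omega

/-! ### Leading monomials and dimensions -/

open Classical in
/-- The exponent vectors of degree `d` of the leading monomials, in the lexicographic order, of the
nonzero members of `V`. -/
noncomputable def leadingExponents {k : Type*} [Field k] {n : ℕ}
    (V : Submodule k (MvPolynomial (Fin n) k)) (d : ℕ) : Finset (Fin n → ℕ) :=
  (Finset.finAntidiagonal n d).filter fun a =>
    ∃ f ∈ V, f ≠ 0 ∧ ⇑(MonomialOrder.lex.degree f) = a

section LeadingExponents

variable {k : Type*} [Field k] {n d : ℕ}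

theorem leadingExponents_subset (V : Submodule k (MvPolynomial (Fin n) k)) (d : ℕ) :
    leadingExponents V d ⊆ Finset.finAntidiagonal n d := by
  classical
  exact Finset.filter_subset _ _

theorem mem_leadingExponents {V : Submodule k (MvPolynomial (Fin n) k)}
    (hV : V ≤ MvPolynomial.homogeneousSubmodule (Fin n) k d) {a : Fin n → ℕ} :
    a ∈ leadingExponents V d ↔ ∃ f ∈ V, f ≠ 0 ∧ ⇑(MonomialOrder.lex.degree f) = a := by
  simp only [leadingExponents, Finset.mem_filter, and_iff_right_iff_imp]
  rintro ⟨f, hf, hf0, rfl⟩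
  have h := (MvPolynomial.mem_homogeneousSubmodule d f).1 (hV hf)
    (MonomialOrder.lex.coeff_degree_ne_zero_iff.2 hf0)
  rw [Finset.mem_finAntidiagonal, ← h, Finsupp.weight_apply, Finsupp.sum_fintype] <;> simp

/-- Reading off the coefficients at all leading exponents kills only `0`: a nonzero member has a
nonzero coefficient at its own. -/
theorem exists_injective_coeff_leadingExponents {V : Submodule k (MvPolynomial (Fin n) k)}
    (hV : V ≤ MvPolynomial.homogeneousSubmodule (Fin n) k d) :
    ∃ φ : V →ₗ[k] (leadingExponents V d → k), Function.Injective φ := by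
  refine ⟨LinearMap.pi fun a =>
    (MvPolynomial.lcoeff k (Finsupp.equivFunOnFinite.symm a.1)).comp V.subtype, ?_⟩
  rw [← LinearMap.ker_eq_bot, LinearMap.ker_eq_bot']
  intro f hf
  by_contra hf0
  have hf0' : (f : MvPolynomial (Fin n) k) ≠ 0 := fun h => hf0 (Subtype.ext h)
  have := congrFun hf ⟨_, (mem_leadingExponents hV).2 ⟨f, f.2, hf0', rfl⟩⟩
  apply MonomialOrder.lex.coeff_degree_ne_zero_iff.2 hf0'
  simpa using this

theorem linearIndependent_of_degree_injective {ι : Type*} [Fintype ι]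
    (f : ι → MvPolynomial (Fin n) k) (hf : ∀ a, f a ≠ 0)
    (hinj : Function.Injective fun a => MonomialOrder.lex.degree (f a)) :
    LinearIndependent k f := by
  classical
  rw [Fintype.linearIndependent_iff]
  intro g hg
  by_contra! hne
  obtain ⟨a₀, ha₀⟩ := hne
  obtain ⟨a, ha, hmax⟩ := Finset.exists_max_image (Finset.univ.filter fun a => g a ≠ 0)
    (fun a => MonomialOrder.lex.toSyn (MonomialOrder.lex.degree (f a))) ⟨a₀, by simpa using ha₀⟩
  have hga : g a ≠ 0 := by simpa using ha
  have hcoeff := congrArg (MvPolynomial.coeff (MonomialOrder.lex.degree (f a))) hg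
  rw [MvPolynomial.coeff_sum, Finset.sum_eq_single a, MvPolynomial.coeff_smul,
    MvPolynomial.coeff_zero, smul_eq_mul] at hcoeff
  · exact mul_ne_zero hga (MonomialOrder.lex.coeff_degree_ne_zero_iff.2 (hf a)) hcoeff
  · intro b _ hb
    rw [MvPolynomial.coeff_smul]
    by_cases hgb : g b = 0
    · rw [hgb, zero_smul]
    · rw [MonomialOrder.lex.coeff_eq_zero_of_lt, smul_zero]
      refine lt_of_le_of_ne (hmax b (by simpa using hgb)) fun h => hb (hinj ?_)
      exact MonomialOrder.lex.toSyn.injective h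
  · exact fun h => absurd (Finset.mem_univ a) h

theorem finite_of_le_homogeneousSubmodule {V : Submodule k (MvPolynomial (Fin n) k)}
    (hV : V ≤ MvPolynomial.homogeneousSubmodule (Fin n) k d) : Module.Finite k V := by
  obtain ⟨φ, hφ⟩ := exists_injective_coeff_leadingExponents hV
  exact Module.Finite.of_injective φ hφ

theorem finrank_eq_card_leadingExponents {V : Submodule k (MvPolynomial (Fin n) k)}
    (hV : V ≤ MvPolynomial.homogeneousSubmodule (Fin n) k d) :
    Module.finrank k V = (leadingExponents V d).card := by
  have := finite_of_le_homogeneousSubmodule hV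
  apply le_antisymm
  · obtain ⟨φ, hφ⟩ := exists_injective_coeff_leadingExponents hV
    simpa using LinearMap.finrank_le_finrank_of_injective hφ
  · choose f hfV hf0 hfa using fun a : leadingExponents V d => (mem_leadingExponents hV).1 a.2
    have hli := linearIndependent_of_degree_injective f hf0 fun a b h =>
      Subtype.ext ((hfa a).symm.trans ((congrArg DFunLike.coe h).trans (hfa b)))
    have hli' : LinearIndependent k fun a => (⟨f a, hfV a⟩ : V) :=
      LinearIndependent.of_comp V.subtype hli
    simpa using hli'.fintype_card_le_finrank

theorem finrank_homogeneousSubmodule (k : Type*) [Field k] (n d : ℕ) :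
    Module.finrank k (MvPolynomial.homogeneousSubmodule (Fin n) k d) =
      monomialCount n (d + 1) := by
  rw [finrank_eq_card_leadingExponents le_rfl, ← card_finAntidiagonal]
  congr 1
  refine Finset.Subset.antisymm (leadingExponents_subset _ _) fun a ha => ?_
  classical
  refine (mem_leadingExponents le_rfl).2
    ⟨MvPolynomial.monomial (Finsupp.equivFunOnFinite.symm a) 1, ?_, ?_, ?_⟩
  · refine MvPolynomial.isHomogeneous_monomial _ ?_
    rw [Finsupp.degree_eq_sum]
    simpa using ha
  · simp
  · rw [MonomialOrder.degree_monomial, if_neg one_ne_zero]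
    rfl

theorem idealComponent_le (I : Ideal (MvPolynomial (Fin n) k)) (d : ℕ) :
    idealComponent I d ≤ MvPolynomial.homogeneousSubmodule (Fin n) k d :=
  inf_le_right

theorem upperShadow_leadingExponents_subset (I : Ideal (MvPolynomial (Fin n) k)) (d : ℕ) :
    upperShadow (leadingExponents (idealComponent I d) d) ⊆
      leadingExponents (idealComponent I (d + 1)) (d + 1) := by
  intro x hx
  obtain ⟨i, a, ha, rfl⟩ := mem_upperShadow.1 hx
  obtain ⟨f, ⟨hfI, hfd⟩, hf0, rfl⟩ := (mem_leadingExponents (idealComponent_le I d)).1 ha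
  refine (mem_leadingExponents (idealComponent_le I (d + 1))).2
    ⟨f * MvPolynomial.X i, ⟨I.mul_mem_right _ hfI, ?_⟩, ?_, ?_⟩
  · exact MvPolynomial.IsHomogeneous.mul hfd (MvPolynomial.isHomogeneous_X k i)
  · exact mul_ne_zero hf0 (MvPolynomial.X_ne_zero i)
  · rw [MonomialOrder.degree_mul hf0 (MvPolynomial.X_ne_zero i), MonomialOrder.degree_X,
      Finsupp.coe_add, Finsupp.single_eq_pi_single]

theorem lexGrowth_finrank_idealComponent_le (I : Ideal (MvPolynomial (Fin n) k)) (d : ℕ) :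
    lexGrowth n (d + 1) (Module.finrank k (idealComponent I d)) ≤
      Module.finrank k (idealComponent I (d + 1)) := by
  rw [finrank_eq_card_leadingExponents (idealComponent_le I d),
    finrank_eq_card_leadingExponents (idealComponent_le I (d + 1))]
  exact (lexGrowth_card_le_card_upperShadow _ (leadingExponents_subset _ _)).trans
    (Finset.card_le_card (upperShadow_leadingExponents_subset I d))

theorem finrank_quotientComponent_add_finrank_idealComponent
    (I : Ideal (MvPolynomial (Fin n) k)) (d : ℕ) :
    Module.finrank k (quotientComponent I d) + Module.finrank k (idealComponent I d) =
      monomialCount n (d + 1) := by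
  set S := MvPolynomial.homogeneousSubmodule (Fin n) k d
  have : Module.Finite k S := finite_of_le_homogeneousSubmodule le_rfl
  set φ := (Ideal.Quotient.mkₐ k I).toLinearMap
  have hrange : LinearMap.range (φ.domRestrict S) = quotientComponent I d :=
    LinearMap.range_domRestrict S φ
  have hker : (LinearMap.ker (φ.domRestrict S)).map S.subtype = idealComponent I d := by
    ext f
    simp only [Submodule.mem_map, LinearMap.mem_ker, LinearMap.domRestrict_apply,
      Submodule.subtype_apply, Subtype.exists, exists_and_right, exists_eq_right, idealComponent,
      Submodule.mem_inf, Submodule.restrictScalars_mem]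
    constructor
    · rintro ⟨hf, h0⟩
      exact ⟨Ideal.Quotient.eq_zero_iff_mem.1 h0, hf⟩
    · rintro ⟨hI, hf⟩
      exact ⟨hf, Ideal.Quotient.eq_zero_iff_mem.2 hI⟩
  have := LinearMap.finrank_range_add_finrank_ker (φ.domRestrict S)
  rwa [hrange, ← Submodule.finrank_map_subtype_eq, hker, finrank_homogeneousSubmodule] at this

end LeadingExponents

/-! ### Conclusion -/

theorem mainTheorem8 {k : Type*} [Field k] (n δ : ℕ) (I : Ideal (MvPolynomial (Fin n) k))
    (hI : I.IsHomogeneous (MvPolynomial.homogeneousSubmodule (Fin n) k)) :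
    -- growth of the quotient
    (1 ≤ δ →
      (∃! t : Fin δ → ℕ, IsMacaulayRep δ (Module.finrank k (quotientComponent I δ)) t) ∧
      ∀ t : Fin δ → ℕ, IsMacaulayRep δ (Module.finrank k (quotientComponent I δ)) t →
        Module.finrank k (quotientComponent I (δ + 1)) ≤
          ∑ j : Fin δ, (t j + 1).choose ((j + 1) + 1)) ∧
    -- growth of the ideal; only the nonvanishing terms of the representation contribute
    (2 ≤ n →
      (∃! s : Fin (n - 1) → ℕ,
        IsMacaulayRep (n - 1) (Module.finrank k (idealComponent I δ)) s) ∧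
      ∀ s : Fin (n - 1) → ℕ,
        IsMacaulayRep (n - 1) (Module.finrank k (idealComponent I δ)) s →
        ∑ j : Fin (n - 1), (if (j : ℕ) + 1 ≤ s j then (s j + 1).choose (j + 1) else 0) ≤
          Module.finrank k (idealComponent I (δ + 1))) := by
  have hsum := finrank_quotientComponent_add_finrank_idealComponent I
  have hgrowth := lexGrowth_finrank_idealComponent_le I δ
  refine ⟨fun hδ => ⟨existsUnique_macaulayRep _ _ hδ, fun t ht => ?_⟩,
    fun hn => ⟨existsUnique_macaulayRep _ _ (by omega), fun s hs => ?_⟩⟩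
  · have h := ht.monomialCount_le n (by have := hsum δ; omega)
    rw [← hsum δ, Nat.add_sub_cancel_left, ← hsum (δ + 1)] at h
    omega
  · obtain ⟨p, rfl⟩ : ∃ p, n = p + 1 := ⟨n - 1, by omega⟩
    exact (hs.le_lexGrowth (δ + 1) (Nat.le.intro (Nat.add_comm _ _ ▸ hsum δ))).trans hgrowth
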